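/- Let $F$ be an algebraically closed field, let $U,V,W$ be finite-dimensional vector spaces over $F$, and let $r\ge 0$ be an integer. For $T\in U\otimes V\otimes W$ and $x\in U^*$ let $Tx\in V\otimes W$ be the contraction of $T$ with $x$ in the first factor. The minrank of $T$ is the minimum of $\operatorname{rk}(Tx)$ over all nonzero $x\in U^*$ (and $\infty$ if $U=0$). Put \[ \mathcal M_{U\otimes V\otimes W,r}=\{T\in U\otimes V\otimes W \mid \exists\, x\in U^*\setminus\{0\}:\ \operatorname{rk}(Tx)\le r\}. \] (a) $\mathcal M_{U\otimes V\otimes W,r}$ is the set of tensors in $U\otimes V\otimes W$ of minrank at most $r$, and it is Zariski closed. Moreover, the set \[ \mathbb P\mathcal X_r=\{([T],[x])\in\mathbb P(U\otimes V\otimes W)\times\mathbb P(U^*) \mid \operatorname{rk}(Tx)\le r\} \] is Zariski closed, its image under the projection to the first factor is \[ \mathbb P\mathcal M_r=\{[T]\in\mathbb P(U\otimes V\otimes W)\mid \exists\, x\ne 0:\ \operatorname{rk}(Tx)\le r\}, \] the set $\mathbb P\mathcal M_r$ is Zariski closed in $\mathbb P(U\otimes V\otimes W)$, and, if $U\neq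 0$, $\mathcal M_{U\otimes V\otimes W,r}$ is the affine cone over $\mathbb P\mathcal M_r$ (with the origin included). (b) Let $\dim U=k\ge 1$, let $n\ge 0$, and let $L$ be a vector space over $F$ of dimension $(k-1)n+r$. Let $(e_i)_{1\le i\le k}$ be a basis of $U$ and let $(e_{ij})$, where $1\le i\le k$, $1\le j\le r$ if $i=1$ and $1\le j\le n$ if $i\ge 2$, be a basis of $L$. Let \[ T_{k,n,r}=e_1\otimes\Bigl(\sum_{j=1}^{r}e_{1j}\otimes e_{1j}\Bigr)+\sum_{i=2}^{k}e_i\otimes\Bigl(\sum_{j=1}^{n}e_{ij}\otimes e_{ij}\Bigr)\in U\otimes L\otimes L . \] Then for all subspaces $V',W'\subseteq L$ with $\dim V'=n$, \[ \mathcal M_{U\otimes V'\otimes W',r}=\overline{\bigl(\mathsf{GL}(U)\times\mathsf{GL}(L)\times\mathsf{GL}(L)\bigr)\,T_{k,n,r}}\ \cap\ (U\otimes V'\otimes W'), \] where the bar is the Zariski closure in $U\otimes L\otimes L$ and $U\otimes V'\otimes W'$ is regarded as a subspace of $U\otimes L\otimes L$. -/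

import Mathlib

open scoped TensorProduct LinearAlgebra.Projectivization

noncomputable section

namespace Minrank

section Zariski

variable (F : Type*) [Field F] {E E' : Type*} [AddCommGroup E] [Module F E]
  [AddCommGroup E'] [Module F E']

/-- The value at the vector `v` of a polynomial expression in linear functionals on `E`.
The functions `v ↦ polyEval F p v` are exactly the polynomial functions on `E`. -/
def polyEval (p : MvPolynomial (Module.Dual F E) F) (v : E) : F :=
  MvPolynomial.eval (fun φ : Module.Dual F E => φ v) p

/-- A subset of a vector space is Zariski closed if it is the set of common zeros of
a family of polynomial functions. -/
def IsZariskiClosed (Z : Set E) : Prop :=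
  ∃ S : Set (MvPolynomial (Module.Dual F E) F), Z = {v | ∀ p ∈ S, polyEval F p v = 0}

/-- The Zariski closure: the intersection of all Zariski closed sets containing `A`. -/
def zariskiClosure (A : Set E) : Set E :=
  ⋂₀ {Z | IsZariskiClosed F Z ∧ A ⊆ Z}

/-- A subset of the projective space `ℙ(E)` is Zariski closed if it is the set of common
zeros of a family of homogeneous polynomials (the vanishing of such a polynomial at a point
does not depend on the representative). -/
def IsProjClosed (Z : Set (ℙ F E)) : Prop :=
  ∃ S : Set (MvPolynomial (Module.Dual F E) F), (∀ p ∈ S, ∃ d : ℕ, p.IsHomogeneous d) ∧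
    Z = {z | ∀ p ∈ S, polyEval F p z.rep = 0}

/-- `p` is homogeneous of bidegree `d` in two groups of variables. -/
def IsBihomogeneous {σ τ : Type*} (p : MvPolynomial (σ ⊕ τ) F) (d : ℕ × ℕ) : Prop :=
  p.IsWeightedHomogeneous (Sum.elim (fun _ => ((1, 0) : ℕ × ℕ)) (fun _ => ((0, 1) : ℕ × ℕ))) d

/-- A subset of `ℙ(E) × ℙ(E')` is Zariski closed if it is the set of common zeros of a
family of bihomogeneous polynomials. -/
def IsBiprojClosed (Z : Set (ℙ F E × ℙ F E')) : Prop :=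
  ∃ S : Set (MvPolynomial (Module.Dual F E ⊕ Module.Dual F E') F),
    (∀ p ∈ S, ∃ d : ℕ × ℕ, IsBihomogeneous F p d) ∧
    Z = {z | ∀ p ∈ S, MvPolynomial.eval
      (Sum.elim (fun φ : Module.Dual F E => φ z.1.rep)
        (fun ψ : Module.Dual F E' => ψ z.2.rep)) p = 0}

/-- The affine cone over a subset of projective space, with the origin included. -/
def affineCone (Z : Set (ℙ F E)) : Set E :=
  {v | ∀ hv : v ≠ 0, Projectivization.mk F v hv ∈ Z}

end Zariski

section Tensors

variable (F : Type*) [Field F]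

/-- Contraction of the first tensor factor: `contract F x (u ⊗ₜ m) = x u • m`. -/
def contract {U M : Type*} [AddCommGroup U] [Module F U] [AddCommGroup M] [Module F M] :
    Module.Dual F U →ₗ[F] (U ⊗[F] M) →ₗ[F] M :=
  LinearMap.compr₂ (LinearMap.rTensorHom M) (TensorProduct.lid F M).toLinearMap

/-- The rank of `A ∈ V ⊗ W`, i.e. the rank of the linear map `V* → W`, `φ ↦ (φ ⊗ id) A`. -/
def rk {V W : Type*} [AddCommGroup V] [Module F V] [AddCommGroup W] [Module F W]
    (A : V ⊗[F] W) : ℕ :=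
  Module.finrank F (LinearMap.range ((contract F (U := V) (M := W)).flip A))

variable (U V W : Type*) [AddCommGroup U] [Module F U] [AddCommGroup V] [Module F V]
  [AddCommGroup W] [Module F W]

/-- The minrank of `T`: the minimum of `rk (T x)` over nonzero `x ∈ U*`
(`⊤` if there is no nonzero `x`). -/
def minrank {U V W : Type*} [AddCommGroup U] [Module F U] [AddCommGroup V] [Module F V]
    [AddCommGroup W] [Module F W] (T : U ⊗[F] (V ⊗[F] W)) : ℕ∞ :=
  ⨅ (x : Module.Dual F U) (_ : x ≠ 0), (rk F (contract F x T) : ℕ∞)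

/-- The affine minrank variety. -/
def minrankVariety (r : ℕ) : Set (U ⊗[F] (V ⊗[F] W)) :=
  {T | ∃ x : Module.Dual F U, x ≠ 0 ∧ rk F (contract F x T) ≤ r}

/-- The projective minrank variety (the condition on `[T]` does not depend on the
representative `T`). -/
def projMinrankVariety (r : ℕ) : Set (ℙ F (U ⊗[F] (V ⊗[F] W))) :=
  {t | ∃ x : Module.Dual F U, x ≠ 0 ∧ rk F (contract F x t.rep) ≤ r}

/-- The projective incidence variety of all `([T], [x])` with `rk (T x) ≤ r` (again
independent of the representatives). -/
def projIncidence (r : ℕ) : Set (ℙ F (U ⊗[F] (V ⊗[F] W)) × ℙ F (Module.Dual F U)) :=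
  {z | rk F (contract F z.2.rep z.1.rep) ≤ r}

/-- The inclusion `U ⊗ V ⊗ W → U ⊗ L ⊗ L` for subspaces `V`, `W` of `L`. -/
def padding {L : Type*} [AddCommGroup L] [Module F L] (V W : Submodule F L) :
    U ⊗[F] (V ⊗[F] W) →ₗ[F] U ⊗[F] (L ⊗[F] L) :=
  TensorProduct.map LinearMap.id (TensorProduct.map V.subtype W.subtype)

/-- The orbit of `T` under the standard action of `GL(U) × GL(V) × GL(W)`. -/
def orbit {U V W : Type*} [AddCommGroup U] [Module F U] [AddCommGroup V] [Module F V]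
    [AddCommGroup W] [Module F W] (T : U ⊗[F] (V ⊗[F] W)) : Set (U ⊗[F] (V ⊗[F] W)) :=
  Set.range fun g : (U ≃ₗ[F] U) × (V ≃ₗ[F] V) × (W ≃ₗ[F] W) =>
    TensorProduct.map g.1.toLinearMap
      (TensorProduct.map g.2.1.toLinearMap g.2.2.toLinearMap) T

end Tensors

/-- Index set of the basis `e_{ij}` of `L = L_1 ⊕ ⋯ ⊕ L_k` with `dim L_1 = r` and
`dim L_i = n` for `i > 1` (indices are counted from `0`). -/
abbrev BlockIndex (k n r : ℕ) : Type :=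
  Σ i : Fin k, Fin (if (i : ℕ) = 0 then r else n)

theorem card_blockIndex (k n r : ℕ) (hk : 1 ≤ k) :
    Fintype.card (BlockIndex k n r) = (k - 1) * n + r := by
  obtain ⟨m, rfl⟩ : ∃ m, k = m + 1 := ⟨k - 1, by omega⟩
  simp [Fin.sum_univ_succ, add_comm]

/-- The tensor `T_{k,n,r} = ∑ᵢ eᵢ ⊗ ∑ⱼ eᵢⱼ ⊗ eᵢⱼ`, with respect to a basis `e_i` of `U` and a
basis `e_{ij}` of `L`. -/
def blockTensor (F : Type*) [Field F] {U L : Type*} [AddCommGroup U] [Module F U]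
    [AddCommGroup L] [Module F L] {k n r : ℕ} (bU : Module.Basis (Fin k) F U)
    (bL : Module.Basis (BlockIndex k n r) F L) : U ⊗[F] (L ⊗[F] L) :=
  ∑ i : Fin k, bU i ⊗ₜ[F] ∑ j : Fin (if (i : ℕ) = 0 then r else n),
    bL ⟨i, j⟩ ⊗ₜ[F] bL ⟨i, j⟩

end Minrank

end

/-! (a) The condition `rk (Tx) ≤ r` is the vanishing of all minors of size `r + 1` of a matrix whose
entries are bilinear in `T` and `x`, so the incidence variety is closed. Eliminating `x` is
`exists_eliminant`: homogeneous equations have only the trivial common zero iff, in some degree `d`,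
their multiples span all forms of degree `d` (Nullstellensatz). A nontrivial zero therefore exists
iff all determinants formed from the coefficients of these multiples vanish. The resulting affine
variety is a cone, and the homogeneous components of its equations cut out the projective one.

(b) The block tensor has minrank at most `r`; the minrank variety of `U ⊗ L ⊗ L` is closed and
`GL`-stable, so it contains the orbit closure, and passing from `L ⊗ L` back to `V' ⊗ W'` preserves
rank. Conversely, complete a witness `x` to the first coordinate of a basis `u` of `U` and expand `T
= ∑ u_i ⊗ A_i`. Then `rk A_1 ≤ r`, and `rk A_i ≤ dim V' = n` for the others, so the `A_i` are sums
of as many simple tensors as the blocks have. Hence `T` is the image of the block tensor under some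
`g ⊗ B ⊗ C` with `B`, `C` in `End(L)`. As `B + t` and `C + t` are invertible for almost all `t`,
this image is in the orbit closure (`map_mem_zariskiClosure_orbit`). -/

open scoped TensorProduct LinearAlgebra.Projectivization

noncomputable section

namespace Minrank

/-! ### Rank and nonvanishing minors -/

section Minors

variable {F : Type*} [Field F]

/-- A spanning family of `J → F` contains a square subfamily with nonzero determinant. -/
theorem exists_det_ne_zero_of_span_eq_top {A J : Type*} [Fintype J] [DecidableEq J]
    (v : A → J → F) (h : Submodule.span F (Set.range v) = ⊤) :
    ∃ c : J → A, (Matrix.of (v ∘ c)).det ≠ 0 := by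
  obtain ⟨κ, a, -, hspan, hli⟩ := exists_linearIndependent' F v
  let b := Module.Basis.mk hli (by rw [hspan, h])
  let e : J ≃ κ := (Pi.basisFun F J).indexEquiv b
  refine ⟨a ∘ e, ?_⟩
  have hrows : LinearIndependent F (Matrix.of (v ∘ a ∘ e)).row := hli.comp e e.injective
  rw [Matrix.linearIndependent_rows_iff_isUnit, Matrix.isUnit_iff_isUnit_det] at hrows
  exact hrows.ne_zero

/-- The rank of a linear map is at least `m` iff some `m × m` minor does not vanish. -/
theorem le_finrank_range_iff_exists_minor {M N ι κ : Type*} [AddCommGroup M] [Module F M]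
    [AddCommGroup N] [Module F N] [Finite ι] [Finite κ] (b : Module.Basis ι F M)
    (b' : Module.Basis κ F N) (f : M →ₗ[F] N) (m : ℕ) :
    m ≤ Module.finrank F (LinearMap.range f) ↔
      ∃ (c : Fin m → ι) (d : Fin m → κ),
        (Matrix.of fun i j => b'.repr (f (b (c i))) (d j)).det ≠ 0 := by
  have := Fintype.ofFinite ι
  have := Fintype.ofFinite κ
  have : FiniteDimensional F N := b'.finiteDimensional_of_finite
  have hrange : Submodule.span F (Set.range (f ∘ b)) = LinearMap.range f := by
    rw [Set.range_comp, Submodule.span_image, b.span_eq, LinearMap.range_eq_map]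
  constructor
  · intro hm
    obtain ⟨κ', a, -, hspan, hli⟩ := exists_linearIndependent' F (f ∘ b)
    have : Finite κ' := hli.finite
    have := Fintype.ofFinite κ'
    have hcard : Fintype.card κ' = Module.finrank F (LinearMap.range f) := by
      rw [← hrange, ← hspan, finrank_span_eq_card hli]
    obtain ⟨g⟩ : Nonempty (Fin m ↪ κ') :=
      Function.Embedding.nonempty_of_card_le (by simpa [hcard] using hm)
    let A : Matrix (Fin m) κ F := Matrix.of fun i j => b'.repr (f (b (a (g i)))) j
    have hA : LinearIndependent F A.row :=
      (hli.comp g g.injective).map' b'.equivFun.toLinearMap b'.equivFun.ker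
    -- Independent rows give row rank `m`, so the columns span `F^m` and `m` of them form an
    -- invertible matrix.
    have hcols : Submodule.span F (Set.range A.col) = ⊤ := by
      apply Submodule.eq_top_of_finrank_eq
      rw [← Matrix.rank_eq_finrank_span_cols, hA.rank_matrix]
      simp
    obtain ⟨d, hd⟩ := exists_det_ne_zero_of_span_eq_top _ hcols
    refine ⟨a ∘ g, d, ?_⟩
    rw [← Matrix.det_transpose]
    exact hd
  · rintro ⟨c, d, hdet⟩
    have hrows : LinearIndependent F
        (Matrix.of fun i j => b'.repr (f (b (c i))) (d j)).row := by
      rw [Matrix.linearIndependent_rows_iff_isUnit, Matrix.isUnit_iff_isUnit_det]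
      exact hdet.isUnit
    let q : N →ₗ[F] (Fin m → F) := LinearMap.pi fun j => b'.coord (d j)
    have hli : LinearIndependent F (fun i => f (b (c i))) := by
      apply LinearIndependent.of_comp q
      exact hrows
    have := finrank_span_eq_card hli
    rw [Fintype.card_fin] at this
    rw [← this]
    apply Submodule.finrank_mono
    rw [Submodule.span_le]
    rintro _ ⟨i, rfl⟩
    exact ⟨_, rfl⟩

/-- A determinant of weighted homogeneous entries is weighted homogeneous. -/
theorem isWeightedHomogeneous_det {R σ M ι : Type*} [CommRing R] [AddCommMonoid M]
    [Fintype ι] [DecidableEq ι] {w : σ → M} {m : M} (A : Matrix ι ι (MvPolynomial σ R))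
    (hA : ∀ i j, (A i j).IsWeightedHomogeneous w m) :
    A.det.IsWeightedHomogeneous w (Fintype.card ι • m) := by
  rw [Matrix.det_apply]
  refine MvPolynomial.IsWeightedHomogeneous.sum _ _ _ fun s _ => ?_
  have h := MvPolynomial.IsWeightedHomogeneous.prod Finset.univ (fun i => A (s i) i)
    (fun _ => m) fun i _ => hA (s i) i
  rw [Finset.sum_const, Finset.card_univ] at h
  rcases Int.units_eq_one_or (Equiv.Perm.sign s) with hs | hs
  · simpa [hs] using h
  · simpa [hs] using h.neg

end Minors

/-! ### Elimination theory -/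

section Elimination

open MvPolynomial

variable {F : Type*} [Field F] [IsAlgClosed F]

/-- If polynomials have no common zero other than possibly the origin, then their ideal contains
a power of the irrelevant ideal. -/
theorem exists_pow_idealOfVars_le {σ ι : Type*} [Finite σ] (P : ι → MvPolynomial σ F)
    (h : ∀ x : σ → F, (∀ i, eval x (P i) = 0) → x = 0) :
    ∃ d, idealOfVars σ F ^ d ≤ Ideal.span (Set.range P) := by
  refine Ideal.exists_pow_le_of_le_radical_of_fg ?_ (idealOfVars_fg σ F)
  rw [← vanishingIdeal_zeroLocus_eq_radical (K := F), idealOfVars, Ideal.span_le]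
  rintro _ ⟨s, rfl⟩
  rw [SetLike.mem_coe, mem_vanishingIdeal_iff]
  intro x hx
  have : x = 0 := h x fun i => hx _ (Ideal.subset_span ⟨i, rfl⟩)
  simp [this]

/-- At a zero of a homogeneous polynomial, the part of the polynomial supported in a prescribed
degree vanishes as well. -/
theorem sum_coeff_mul_prod_eq_zero {R K σ : Type*} [CommRing R] [CommRing K] {d e : ℕ}
    [Fintype {j : σ →₀ ℕ // j.degree = d}] (φ : R →+* K) (x : σ → K)
    {q : MvPolynomial σ R} (hq : q.IsHomogeneous e) (h : eval₂ φ x q = 0) :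
    ∑ j : {j : σ →₀ ℕ // j.degree = d}, φ (coeff j.1 q) * j.1.prod (fun s n => x s ^ n) = 0 := by
  rcases eq_or_ne e d with rfl | hne
  · rw [← h]
    change _ = q.support.sum _
    rw [Finset.sum_subset (s₂ := Finset.univ.map
      (Function.Embedding.subtype fun j : σ →₀ ℕ => j.degree = e)), Finset.sum_map]
    · rfl
    · intro j hj
      rw [mem_support_iff] at hj
      simpa using not_imp_comm.mp hq.coeff_eq_zero hj
    · intro j _ hj
      rw [notMem_support_iff] at hj
      change φ (coeff j q) * _ = 0
      rw [hj, map_zero, zero_mul]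
  · refine Finset.sum_eq_zero fun j _ => ?_
    rw [hq.coeff_eq_zero (by rw [j.2]; exact hne.symm), map_zero, zero_mul]

/-- The main theorem of elimination theory: for a family of homogeneous polynomials with
coefficients in `R`, the existence of a nontrivial common zero after specialization along
`φ : R → F` is a closed condition on `φ`. -/
theorem exists_eliminant {R σ ι : Type*} [CommRing R] [Finite σ] (m : ι → ℕ)
    (P : ι → MvPolynomial σ R) (hP : ∀ i, (P i).IsHomogeneous (m i)) :
    ∃ S : Set R, ∀ φ : R →+* F,
      (∃ x : σ → F, x ≠ 0 ∧ ∀ i, eval₂ φ x (P i) = 0) ↔ ∀ s ∈ S, φ s = 0 := by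
  classical
  have (d : ℕ) : Fintype {j : σ →₀ ℕ // j.degree = d} := (Finsupp.finite_of_degree_eq d).fintype
  -- The row of degree-`d` coefficients of a monomial times some `P i`; it is zero if that product
  -- has another degree.
  let row (d : ℕ) (a : (σ →₀ ℕ) × ι) : {j : σ →₀ ℕ // j.degree = d} → R :=
    fun j => coeff j.1 (monomial a.1 1 * P a.2)
  refine ⟨{s | ∃ d c, s = (Matrix.of (row d ∘ c)).det}, fun φ => ⟨?_, ?_⟩⟩
  · rintro ⟨x, hx, hPx⟩ _ ⟨d, c, rfl⟩
    rw [RingHom.map_det, ← Matrix.exists_mulVec_eq_zero_iff]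
    -- The values at `x` of the degree-`d` monomials form a kernel vector; it is nonzero because it
    -- contains `x s ^ d` with `x s ≠ 0`.
    refine ⟨fun j => j.1.prod fun s n => x s ^ n, ?_, ?_⟩
    · obtain ⟨s, hs⟩ := Function.ne_iff.mp hx
      intro h0
      have := congrFun h0 ⟨Finsupp.single s d, by simp⟩
      simp at this
      exact hs this.1
    · funext i
      have hhom : (monomial (c i).1 (1 : R) * P (c i).2).IsHomogeneous
          ((c i).1.degree + m (c i).2) := (isHomogeneous_monomial _ rfl).mul (hP _)
      have hzero : eval₂ φ x (monomial (c i).1 (1 : R) * P (c i).2) = 0 := by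
        rw [eval₂_mul, hPx, mul_zero]
      exact sum_coeff_mul_prod_eq_zero φ x hhom hzero
  · contrapose!
    intro h
    obtain ⟨d, hd⟩ := exists_pow_idealOfVars_le (fun i => map φ (P i)) fun x hx => by
      by_contra hx0
      obtain ⟨i, hi⟩ := h x hx0
      exact hi (by rw [← eval_map]; exact hx i)
    have hspan : Submodule.span F (Set.range fun a j => φ (row d a j)) = ⊤ := by
      -- A functional `l` killing all rows extends, through the degree-`d` coefficients, to `q`
      -- killing the whole ideal. That ideal contains every monomial of degree `d`, so `l = 0`.
      by_contra hne
      obtain ⟨l, hl, hker⟩ := Submodule.exists_le_ker_of_lt_top _ (lt_top_iff_ne_top.mpr hne)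
      let q : MvPolynomial σ F →ₗ[F] F :=
        l ∘ₗ LinearMap.pi fun j : {j : σ →₀ ℕ // j.degree = d} => lcoeff F j.1
      have hq : ∀ p ∈ Ideal.span (Set.range fun i => map φ (P i)), q p = 0 := by
        intro p hp
        -- `q` is only `F`-linear, so induction over the ideal must carry all multiples of `p`.
        suffices ∀ a, q (a * p) = 0 by simpa using this 1
        induction hp using Submodule.span_induction with
        | mem p hp =>
          obtain ⟨i, rfl⟩ := hp
          intro a
          induction a using MvPolynomial.induction_on' with
          | monomial u t =>
            have hrow : q (monomial u 1 * map φ (P i)) = 0 := by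
              have := hker (Submodule.subset_span ⟨(u, i), rfl⟩)
              rw [LinearMap.mem_ker] at this
              rw [← this]
              refine congrArg l (funext fun j => ?_)
              change coeff j.1 _ = φ (coeff j.1 _)
              rw [← coeff_map, map_mul, map_monomial, φ.map_one]
            rw [show monomial u t = t • monomial u (1 : F) by simp [smul_monomial],
              smul_mul_assoc, map_smul, hrow, smul_zero]
          | add a b ha hb => rw [add_mul, map_add, ha, hb, add_zero]
        | zero => simp
        | add p p' _ _ hp hp' => intro a; rw [mul_add, map_add, hp, hp', add_zero]
        | smul b p _ hp => intro a; rw [smul_eq_mul, ← mul_assoc, hp]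
      apply hl
      refine (Pi.basisFun F _).ext fun j => ?_
      have hj := hq _ (hd ((monomial_mem_pow_idealOfVars_iff d j.1 one_ne_zero).mpr j.2.ge))
      rw [LinearMap.zero_apply, ← hj]
      refine congrArg l (funext fun j' => ?_)
      simp [Pi.single_apply, coeff_monomial, Subtype.ext_iff, eq_comm]
    obtain ⟨c, hc⟩ := exists_det_ne_zero_of_span_eq_top _ hspan
    refine ⟨_, ⟨d, c, rfl⟩, ?_⟩
    rw [RingHom.map_det]
    exact hc

end Elimination

/-! ### Contraction and tensor rank -/

section Contraction

variable {F : Type*} [Field F] {U V W M U' V' W' M' : Type*}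
  [AddCommGroup U] [Module F U] [AddCommGroup V] [Module F V] [AddCommGroup W] [Module F W]
  [AddCommGroup M] [Module F M] [AddCommGroup U'] [Module F U'] [AddCommGroup V'] [Module F V']
  [AddCommGroup W'] [Module F W'] [AddCommGroup M'] [Module F M']

@[simp]
theorem contract_tmul (x : Module.Dual F U) (u : U) (m : M) :
    contract F x (u ⊗ₜ[F] m) = x u • m := by
  simp [contract]

theorem contract_map (x : Module.Dual F U') (f : U →ₗ[F] U') (g : M →ₗ[F] M') (T : U ⊗[F] M) :
    contract F x (TensorProduct.map f g T) = g (contract F (x ∘ₗ f) T) := by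
  induction T with
  | zero => simp
  | tmul u m => simp
  | add T T' h h' => simp only [map_add, h, h']

/-- Expansion of a tensor with respect to a basis of the first factor. -/
theorem sum_basis_tmul_contract {ι : Type*} [Fintype ι] (b : Module.Basis ι F U)
    (T : U ⊗[F] M) : ∑ i, b i ⊗ₜ[F] contract F (b.coord i) T = T := by
  induction T with
  | zero => simp
  | tmul u m =>
    simp_rw [contract_tmul, TensorProduct.tmul_smul, TensorProduct.smul_tmul']
    rw [← TensorProduct.sum_tmul]
    simp [b.sum_repr]
  | add T T' h h' =>
    simp only [map_add, TensorProduct.tmul_add, Finset.sum_add_distrib, h, h']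

theorem rk_map_le [FiniteDimensional F W] (f : V →ₗ[F] V') (g : W →ₗ[F] W') (A : V ⊗[F] W) :
    rk F (TensorProduct.map f g A) ≤ rk F A := by
  have hle : LinearMap.range ((contract F).flip (TensorProduct.map f g A)) ≤
      (LinearMap.range ((contract F).flip A)).map g := by
    rintro _ ⟨x, rfl⟩
    exact ⟨_, ⟨x ∘ₗ f, rfl⟩, (contract_map x f g A).symm⟩
  exact (Submodule.finrank_mono hle).trans (Submodule.finrank_map_le _ _)

theorem rk_map_of_injective [FiniteDimensional F W] (f : V →ₗ[F] V') (g : W →ₗ[F] W')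
    (hf : Function.Injective f) (hg : Function.Injective g) (A : V ⊗[F] W) :
    rk F (TensorProduct.map f g A) = rk F A := by
  have heq : LinearMap.range ((contract F).flip (TensorProduct.map f g A)) =
      (LinearMap.range ((contract F).flip A)).map g := by
    apply le_antisymm
    · rintro _ ⟨x, rfl⟩
      exact ⟨_, ⟨x ∘ₗ f, rfl⟩, (contract_map x f g A).symm⟩
    · rintro _ ⟨_, ⟨y, rfl⟩, rfl⟩
      -- Since `f` is injective, every functional on `V` is the pullback of one on `V'`.
      obtain ⟨x, rfl⟩ := LinearMap.dualMap_surjective_of_injective hf y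
      exact ⟨x, contract_map x f g A⟩
  rw [rk, heq]
  exact (Submodule.equivMapOfInjective g hg _).finrank_eq.symm

theorem rk_smul_le [FiniteDimensional F W] (c : F) (A : V ⊗[F] W) :
    rk F (c • A) ≤ rk F A := by
  have := rk_map_le (LinearMap.id : V →ₗ[F] V) (c • LinearMap.id : W →ₗ[F] W) A
  rwa [TensorProduct.map_smul_right, TensorProduct.map_id] at this

theorem rk_sum_tmul_le {J : Type*} [Fintype J] (v : J → V) (w : J → W) :
    rk F (∑ j, v j ⊗ₜ[F] w j) ≤ Fintype.card J := by
  have := FiniteDimensional.span_of_finite F (Set.finite_range w)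
  refine le_trans (Submodule.finrank_mono (t := Submodule.span F (Set.range w)) ?_)
    (finrank_range_le_card w)
  rintro _ ⟨x, rfl⟩
  rw [LinearMap.flip_apply, map_sum]
  refine Submodule.sum_mem _ fun j _ => ?_
  rw [contract_tmul]
  exact Submodule.smul_mem _ _ (Submodule.subset_span ⟨j, rfl⟩)

theorem rk_le_finrank_left [FiniteDimensional F V] (A : V ⊗[F] W) :
    rk F A ≤ Module.finrank F V :=
  (LinearMap.finrank_range_le _).trans Subspace.dual_finrank_eq.le

/-- A tensor of rank at most `card J` is a sum of simple tensors indexed by `J`. -/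
theorem exists_eq_sum_tmul_of_rk_le [FiniteDimensional F V] [FiniteDimensional F W] {J : Type*}
    [Fintype J] (A : V ⊗[F] W) (hA : rk F A ≤ Fintype.card J) :
    ∃ (v : J → V) (w : J → W), A = ∑ j, v j ⊗ₜ[F] w j := by
  let R := LinearMap.range ((contract F).flip A)
  let c := Module.finBasis F R
  let b := Module.finBasis F V
  obtain ⟨e⟩ : Nonempty (Fin (Module.finrank F R) ↪ J) :=
    Function.Embedding.nonempty_of_card_le (by rwa [Fintype.card_fin])
  let y (a : Fin (Module.finrank F V)) : R := ⟨contract F (b.coord a) A, ⟨b.coord a, rfl⟩⟩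
  let v (i : Fin (Module.finrank F R)) : V := ∑ a, c.repr (y a) i • b a
  -- Rank factorization: expand `A` in a basis of `V`, then each contraction in the basis `c` of the
  -- range, and regroup by `c`.
  have hsum : A = ∑ i, v i ⊗ₜ[F] (c i : W) := by
    conv_lhs => rw [← sum_basis_tmul_contract b A]
    simp_rw [v, TensorProduct.sum_tmul]
    rw [Finset.sum_comm]
    refine Finset.sum_congr rfl fun a _ => ?_
    have hy : contract F (b.coord a) A = ∑ i, c.repr (y a) i • (c i : W) := by
      have := congrArg R.subtype (c.sum_repr (y a))
      rw [map_sum] at this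
      exact this.symm
    rw [hy, TensorProduct.tmul_sum]
    simp_rw [TensorProduct.tmul_smul, TensorProduct.smul_tmul']
  -- The rank may be smaller than the cardinality of `J`; the remaining terms are zero.
  refine ⟨Function.extend e v 0, Function.extend e (fun i => (c i : W)) 0, ?_⟩
  rw [hsum]
  refine Finset.sum_of_injOn e e.injective.injOn (by simp) ?_ ?_
  · intro j _ hj
    have : ¬ ∃ i, e i = j := by simpa using hj
    simp [Function.extend_apply' _ _ _ this]
  · intro i _
    simp [e.injective.extend_apply]

/-- The `(a, b)` coordinate of the contraction with the `i`-th dual basis vector. -/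
def tensorCoord {ι κ μ : Type*} (bU : Module.Basis ι F U) (bV : Module.Basis κ F V)
    (bW : Module.Basis μ F W) (i : ι) (a : κ) (b : μ) : Module.Dual F (U ⊗[F] (V ⊗[F] W)) :=
  bW.coord b ∘ₗ contract F (bV.coord a) ∘ₗ contract F (bU.coord i)

/-- The explicit bilinear entries serve twice: as linear forms in `x` with coefficients depending on
`T` for elimination, and as bihomogeneous equations for the incidence variety. -/
theorem rk_contract_le_iff_forall_minor {ι κ μ : Type*} [Fintype ι] [Finite κ] [Finite μ]
    (bU : Module.Basis ι F U) (bV : Module.Basis κ F V) (bW : Module.Basis μ F W)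
    (x : Module.Dual F U) (T : U ⊗[F] (V ⊗[F] W)) (r : ℕ) :
    rk F (contract F x T) ≤ r ↔ ∀ cd : (Fin (r + 1) → κ) × (Fin (r + 1) → μ),
      (Matrix.of fun p q =>
        ∑ i, x (bU i) * tensorCoord bU bV bW i (cd.1 p) (cd.2 q) T).det = 0 := by
  classical
  have := Fintype.ofFinite κ
  have hentry (a : κ) (b : μ) : bW.repr ((contract F).flip (contract F x T) (bV.dualBasis a)) b =
      ∑ i, x (bU i) * tensorCoord bU bV bW i a b T := by
    conv_lhs => rw [← bU.sum_dual_apply_smul_coord x]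
    simp only [map_sum, map_smul, LinearMap.sum_apply, LinearMap.smul_apply,
      LinearMap.flip_apply, Finsupp.finsetSum_apply, Finsupp.smul_apply, smul_eq_mul,
      Module.Basis.coe_dualBasis, tensorCoord, LinearMap.comp_apply, Module.Basis.coord_apply]
  have := not_congr (le_finrank_range_iff_exists_minor bV.dualBasis bW
    ((contract F).flip (contract F x T)) (r + 1))
  rw [not_le, Nat.lt_succ_iff] at this
  rw [rk, this]
  push Not
  simp_rw [hentry, Prod.forall]

end Contraction

/-! ### Closed cones and polynomial curves -/

section Zariski

variable {F : Type*} [Field F] {E : Type*} [AddCommGroup E] [Module F E]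

theorem zariskiClosure_subset {A Z : Set E} (hZ : IsZariskiClosed F Z) (h : A ⊆ Z) :
    zariskiClosure F A ⊆ Z :=
  Set.sInter_subset_of_mem ⟨hZ, h⟩

theorem polyEval_smul {p : MvPolynomial (Module.Dual F E) F} {d : ℕ} (hp : p.IsHomogeneous d)
    (c : F) (v : E) : polyEval F p (c • v) = c ^ d * polyEval F p v := by
  simp only [polyEval, MvPolynomial.eval_eq, Finset.mul_sum]
  refine Finset.sum_congr rfl fun s hs => ?_
  have hdeg : ∑ i ∈ s.support, s i = d := by
    rw [← hp (MvPolynomial.mem_support_iff.mp hs)]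
    simp [Finsupp.weight_apply, Finsupp.sum]
  simp_rw [map_smul, smul_eq_mul, mul_pow, Finset.prod_mul_distrib, Finset.prod_pow_eq_pow_sum]
  rw [hdeg]
  ring

/-- If a polynomial function vanishes on the line through `v`, then so do its homogeneous
components. -/
theorem polyEval_homogeneousComponent_eq_zero [Infinite F]
    (p : MvPolynomial (Module.Dual F E) F) (v : E) (h : ∀ c : F, polyEval F p (c • v) = 0)
    (d : ℕ) : polyEval F (p.homogeneousComponent d) v = 0 := by
  -- As a polynomial in `c`, `p (c • v)` has the values of the homogeneous components at `v` as
  -- coefficients.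
  let Q : Polynomial F := ∑ i ∈ Finset.range (p.totalDegree + 1),
    Polynomial.monomial i (polyEval F (p.homogeneousComponent i) v)
  have hQ : Q = 0 := by
    refine Polynomial.funext fun c => ?_
    rw [Polynomial.eval_zero, ← h c]
    conv_rhs => rw [← p.sum_homogeneousComponent]
    rw [polyEval, map_sum, Polynomial.eval_finsetSum]
    refine Finset.sum_congr rfl fun i _ => ?_
    rw [Polynomial.eval_monomial, mul_comm]
    exact (polyEval_smul (p.homogeneousComponent_isHomogeneous i) c v).symm
  by_cases hd : d ∈ Finset.range (p.totalDegree + 1)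
  · have := congrArg (Polynomial.coeff · d) hQ
    simpa [Q, Polynomial.finsetSum_coeff, Polynomial.coeff_monomial, Finset.mem_range.mp hd]
      using this
  · rw [p.homogeneousComponent_eq_zero d (by simpa using hd)]
    simp [polyEval]

/-- The projectivization of a Zariski closed cone is Zariski closed. -/
theorem IsZariskiClosed.isProjClosed [Infinite F] {Z : Set E} (hZ : IsZariskiClosed F Z)
    (hcone : ∀ v ∈ Z, ∀ c : F, c • v ∈ Z) : IsProjClosed F {z : ℙ F E | z.rep ∈ Z} := by
  obtain ⟨S, rfl⟩ := hZ
  refine ⟨{q | ∃ p ∈ S, ∃ d, q = p.homogeneousComponent d}, ?_, ?_⟩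
  · rintro _ ⟨p, -, d, rfl⟩
    exact ⟨d, p.homogeneousComponent_isHomogeneous d⟩
  · ext z
    constructor
    · rintro hz _ ⟨p, hp, d, rfl⟩
      exact polyEval_homogeneousComponent_eq_zero p _ (fun c => hcone _ hz c p hp) d
    · intro hz p hp
      rw [← p.sum_homogeneousComponent, polyEval, map_sum]
      exact Finset.sum_eq_zero fun i _ => hz _ ⟨p, hp, i, rfl⟩

/-- A polynomial curve which lies in `A` for infinitely many parameters stays in the Zariski
closure of `A`. -/
theorem mem_zariskiClosure_of_infinite {A : Set E} (γ : F → E)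
    (hγ : ∀ φ : Module.Dual F E, ∃ q : Polynomial F, ∀ t, q.eval t = φ (γ t))
    (hA : {t | γ t ∈ A}.Infinite) (t : F) : γ t ∈ zariskiClosure F A := by
  rintro _ ⟨⟨S, rfl⟩, hS⟩ p hp
  choose q hq using hγ
  let Q : Polynomial F := MvPolynomial.aeval q p
  have hQ (s : F) : Q.eval s = polyEval F p (γ s) := by
    have : (Polynomial.aeval s).comp (MvPolynomial.aeval q) =
        MvPolynomial.aeval (R := F) fun φ : Module.Dual F E => φ (γ s) := by
      ext φ
      simp [hq]
    have := DFunLike.congr_fun this p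
    rwa [AlgHom.comp_apply, Polynomial.coe_aeval_eq_eval] at this
  have hQ0 : Q = 0 := Polynomial.eq_zero_of_infinite_isRoot Q <|
    hA.mono fun s hs => (hQ s).trans (hS hs p hp)
  rw [← hQ, hQ0, Polynomial.eval_zero]

end Zariski

/-! ### Closedness of the minrank varieties -/

section Variety

variable {F : Type*} [Field F] {U V W : Type*} [AddCommGroup U] [Module F U]
  [AddCommGroup V] [Module F V] [AddCommGroup W] [Module F W]

theorem setOf_minrank_le (r : ℕ) :
    {T : U ⊗[F] (V ⊗[F] W) | minrank F T ≤ (r : ℕ∞)} = minrankVariety F U V W r := by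
  ext T
  -- A strict bound on an infimum yields a witness, hence `< r + 1` in place of `≤ r`.
  rw [Set.mem_ofPred_eq, ← ENat.lt_add_one_iff (ENat.natCast_ne_top r), minrank]
  simp_rw [iInf_lt_iff, ENat.lt_add_one_iff (ENat.natCast_ne_top r), Nat.cast_le]
  simp [minrankVariety]

variable [FiniteDimensional F W]

theorem smul_mem_minrankVariety {r : ℕ} {T : U ⊗[F] (V ⊗[F] W)}
    (hT : T ∈ minrankVariety F U V W r) (c : F) : c • T ∈ minrankVariety F U V W r := by
  obtain ⟨x, hx, h⟩ := hT
  refine ⟨x, hx, ?_⟩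
  rw [map_smul]
  exact (rk_smul_le _ _).trans h

theorem isZariskiClosed_minrankVariety [IsAlgClosed F] [FiniteDimensional F U]
    [FiniteDimensional F V] (r : ℕ) :
    IsZariskiClosed F (minrankVariety F U V W r) := by
  let bU := Module.finBasis F U
  let bV := Module.finBasis F V
  let bW := Module.finBasis F W
  let entry (cd : (Fin (r + 1) → Fin (Module.finrank F V)) ×
      (Fin (r + 1) → Fin (Module.finrank F W))) (p q : Fin (r + 1)) :
      MvPolynomial (Fin (Module.finrank F U))
        (MvPolynomial (Module.Dual F (U ⊗[F] (V ⊗[F] W))) F) :=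
    ∑ i, MvPolynomial.X i *
      MvPolynomial.C (MvPolynomial.X (tensorCoord bU bV bW i (cd.1 p) (cd.2 q)))
  obtain ⟨S, hS⟩ := exists_eliminant (F := F) (fun _ => Fintype.card (Fin (r + 1)) • 1)
    (fun cd => (Matrix.of (entry cd)).det) fun cd => by
      refine isWeightedHomogeneous_det (w := 1) (m := 1) _ fun p q => ?_
      rw [Matrix.of_apply]
      refine MvPolynomial.IsWeightedHomogeneous.sum _ _ _ fun i _ => ?_
      exact (MvPolynomial.isHomogeneous_X _ i).mul (MvPolynomial.isHomogeneous_C _ _)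
  refine ⟨S, ?_⟩
  ext T
  -- The coefficient ring consists of polynomials in `T`; specializing it means evaluating at the
  -- given tensor.
  refine Iff.trans ?_ (hS (MvPolynomial.eval fun φ => φ T))
  have heval (x : Module.Dual F U) cd :
      MvPolynomial.eval₂ (MvPolynomial.eval fun φ : Module.Dual F (U ⊗[F] (V ⊗[F] W)) => φ T)
        (bU.dualBasis.equivFun x) (Matrix.of (entry cd)).det =
      (Matrix.of fun p q =>
        ∑ i, x (bU i) * tensorCoord bU bV bW i (cd.1 p) (cd.2 q) T).det := by
    rw [← MvPolynomial.coe_eval₂Hom, RingHom.map_det]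
    congr 1
    ext p q
    simp [entry]
  constructor
  · rintro ⟨x, hx, h⟩
    refine ⟨bU.dualBasis.equivFun x, by simpa using hx, fun cd => ?_⟩
    rw [heval]
    exact (rk_contract_le_iff_forall_minor bU bV bW x T r).mp h cd
  · rintro ⟨y, hy, h⟩
    obtain ⟨x, rfl⟩ := bU.dualBasis.equivFun.surjective y
    refine ⟨x, by simpa using hy, ?_⟩
    rw [rk_contract_le_iff_forall_minor bU bV bW]
    intro cd
    rw [← heval]
    exact h cd

theorem isBiprojClosed_projIncidence [FiniteDimensional F U] [FiniteDimensional F V] (r : ℕ) :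
    IsBiprojClosed F (projIncidence F U V W r) := by
  let bU := Module.finBasis F U
  let bV := Module.finBasis F V
  let bW := Module.finBasis F W
  let entry (cd : (Fin (r + 1) → Fin (Module.finrank F V)) ×
      (Fin (r + 1) → Fin (Module.finrank F W))) (p q : Fin (r + 1)) :
      MvPolynomial (Module.Dual F (U ⊗[F] (V ⊗[F] W)) ⊕ Module.Dual F (Module.Dual F U)) F :=
    ∑ i, MvPolynomial.X (Sum.inr (Module.Dual.eval F U (bU i))) *
      MvPolynomial.X (Sum.inl (tensorCoord bU bV bW i (cd.1 p) (cd.2 q)))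
  refine ⟨Set.range fun cd => (Matrix.of (entry cd)).det, ?_, ?_⟩
  · rintro _ ⟨cd, rfl⟩
    refine ⟨Fintype.card (Fin (r + 1)) • ((0, 1) + (1, 0)), ?_⟩
    refine isWeightedHomogeneous_det (M := ℕ × ℕ) _ fun p q => ?_
    rw [Matrix.of_apply]
    refine MvPolynomial.IsWeightedHomogeneous.sum _ _ _ fun i _ => ?_
    exact (MvPolynomial.isWeightedHomogeneous_X _ _ _).mul
      (MvPolynomial.isWeightedHomogeneous_X _ _ _)
  · ext z
    simp only [projIncidence, Set.mem_ofPred_eq, Set.forall_mem_range]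
    rw [rk_contract_le_iff_forall_minor bU bV bW]
    refine forall_congr' fun cd => ?_
    rw [RingHom.map_det]
    refine Eq.congr (congrArg Matrix.det ?_) rfl
    ext p q
    simp [entry]

theorem image_fst_projIncidence (r : ℕ) :
    Prod.fst '' projIncidence F U V W r = projMinrankVariety F U V W r := by
  ext t
  constructor
  · rintro ⟨z, hz, rfl⟩
    exact ⟨z.2.rep, z.2.rep_nonzero, hz⟩
  · rintro ⟨x, hx, h⟩
    refine ⟨(t, Projectivization.mk F x hx), ?_, rfl⟩
    obtain ⟨a, ha⟩ := Projectivization.exists_smul_eq_mk_rep F x hx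
    change rk F (contract F (Projectivization.mk F x hx).rep t.rep) ≤ r
    rw [← ha, Units.smul_def, map_smul, LinearMap.smul_apply]
    exact (rk_smul_le _ _).trans h

theorem minrankVariety_eq_affineCone [Nontrivial U] (r : ℕ) :
    minrankVariety F U V W r = affineCone F (projMinrankVariety F U V W r) := by
  ext T
  constructor
  · intro hT hT0
    obtain ⟨a, ha⟩ := Projectivization.exists_smul_eq_mk_rep F T hT0
    change (Projectivization.mk F T hT0).rep ∈ minrankVariety F U V W r
    rw [← ha]
    exact smul_mem_minrankVariety hT _
  · intro hT
    by_cases hT0 : T = 0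
    -- The origin belongs to the variety only because a nonzero `x` exists.
    · obtain ⟨x, hx⟩ := exists_ne (0 : Module.Dual F U)
      exact ⟨x, hx, by
        rw [hT0, map_zero, rk, map_zero, LinearMap.range_zero, finrank_bot]; exact r.zero_le⟩
    · obtain ⟨a, ha⟩ := Projectivization.exists_smul_eq_mk_rep F T hT0
      have hrep : (Projectivization.mk F T hT0).rep ∈ minrankVariety F U V W r := hT hT0
      rw [← ha] at hrep
      have := smul_mem_minrankVariety hrep (a⁻¹ : Fˣ)
      rwa [← Units.smul_def, inv_smul_smul] at this

end Variety

/-! ### The orbit closure of the block tensor -/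

section OrbitClosure

variable {F : Type*} [Field F] {U V W L : Type*} [AddCommGroup U] [Module F U]
  [AddCommGroup V] [Module F V] [AddCommGroup W] [Module F W] [AddCommGroup L] [Module F L]

/-- The witness moves along with `g`, from `x` to `x ∘ g⁻¹`, and maps on `V` and `W` do not increase
rank. -/
theorem orbit_subset_minrankVariety [FiniteDimensional F W] {r : ℕ} {T : U ⊗[F] (V ⊗[F] W)}
    (hT : T ∈ minrankVariety F U V W r) : orbit F T ⊆ minrankVariety F U V W r := by
  obtain ⟨x, hx, h⟩ := hT
  rintro _ ⟨⟨g, f, f'⟩, rfl⟩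
  refine ⟨x ∘ₗ g.symm.toLinearMap, ?_, ?_⟩
  · intro h0
    apply hx
    ext u
    simpa using LinearMap.congr_fun h0 (g u)
  · rw [contract_map]
    have : (x ∘ₗ g.symm.toLinearMap) ∘ₗ g.toLinearMap = x := by ext u; simp
    dsimp only
    rw [this]
    exact (rk_map_le _ _ _).trans h

theorem blockTensor_mem_minrankVariety {k n r : ℕ} (hk : 1 ≤ k) (bU : Module.Basis (Fin k) F U)
    (bL : Module.Basis (BlockIndex k n r) F L) :
    blockTensor F bU bL ∈ minrankVariety F U L L r := by
  refine ⟨bU.coord ⟨0, hk⟩, ?_, ?_⟩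
  · intro h
    simpa using LinearMap.congr_fun h (bU ⟨0, hk⟩)
  · have : contract F (bU.coord ⟨0, hk⟩) (blockTensor F bU bL) =
        ∑ j, bL ⟨⟨0, hk⟩, j⟩ ⊗ₜ[F] bL ⟨⟨0, hk⟩, j⟩ := by
      rw [blockTensor, map_sum, Finset.sum_eq_single ⟨0, hk⟩]
      · simp
      · intro i _ hi
        simp [Finsupp.single_eq_of_ne hi.symm]
      · simp
    rw [this]
    exact (rk_sum_tmul_le _ _).trans (by simp)

theorem mem_minrankVariety_of_padding_mem [FiniteDimensional F L] {r : ℕ} {V' W' : Submodule F L}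
    {T : U ⊗[F] (V' ⊗[F] W')} (h : padding F U V' W' T ∈ minrankVariety F U L L r) :
    T ∈ minrankVariety F U V' W' r := by
  obtain ⟨x, hx, h⟩ := h
  refine ⟨x, hx, ?_⟩
  rwa [padding, contract_map, LinearMap.comp_id,
    rk_map_of_injective _ _ V'.injective_subtype W'.injective_subtype] at h

/-- A nonzero functional is a coordinate function of some basis. -/
theorem exists_basis_coord_eq {ι : Type*} [Finite ι] (b : Module.Basis ι F U) (i : ι)
    (x : Module.Dual F U) (hx : x ≠ 0) : ∃ u : Module.Basis ι F U, u.coord i = x := by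
  classical
  have : FiniteDimensional F U := b.finiteDimensional_of_finite
  have hi : b.coord i ≠ 0 := fun h => by simpa using LinearMap.congr_fun h (b i)
  -- An automorphism of `U*` carrying `b.coord i` to `x`, extended from an isomorphism of lines.
  obtain ⟨a, ha⟩ := Submodule.exists_linearEquiv_restrict_eq
    ((LinearEquiv.toSpanNonzeroSingleton F _ _ hi).symm.trans
      (LinearEquiv.toSpanNonzeroSingleton F _ _ hx))
  have hax : a (b.coord i) = x := by
    have := ha ⟨b.coord i, Submodule.mem_span_singleton_self _⟩
    rw [← this, LinearEquiv.trans_apply, ← LinearEquiv.toSpanNonzeroSingleton_one F _ _ hi,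
      LinearEquiv.symm_apply_apply, LinearEquiv.toSpanNonzeroSingleton_one]
  let d := b.dualBasis.map a
  -- By reflexivity, `d` is the dual basis of a basis `u` of `U`.
  let u := d.dualBasis.map (Module.evalEquiv F U).symm
  refine ⟨u, u.ext fun j => ?_⟩
  have hxu : x (u j) = d.repr x j := by
    rw [← d.dualBasis_apply]
    change Module.evalEquiv F U (u j) x = _
    rw [Module.Basis.map_apply, LinearEquiv.apply_symm_apply]
  have hd : x = d i := by simp [d, hax]
  rw [hxu, hd, d.repr_self, Module.Basis.coord_apply, u.repr_self, Finsupp.single_apply,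
    Finsupp.single_apply]
  simp only [eq_comm]

/-- All of `End(V) × End(W)` moves a tensor only within the closure of its orbit. -/
theorem map_mem_zariskiClosure_orbit [Infinite F] [FiniteDimensional F V] [FiniteDimensional F W]
    (T : U ⊗[F] (V ⊗[F] W)) (g : U ≃ₗ[F] U) (B : V →ₗ[F] V) (C : W →ₗ[F] W) :
    TensorProduct.map g.toLinearMap (TensorProduct.map B C) T ∈ zariskiClosure F (orbit F T) := by
  let m (B : Module.End F V) (C : Module.End F W) : U ⊗[F] (V ⊗[F] W) :=
    TensorProduct.map g.toLinearMap (TensorProduct.map B C) T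
  -- `B + t` is singular only if `t` is in the finite spectrum of `-B`, and likewise for `C`; so
  -- this quadratic curve meets the orbit infinitely often and passes through the target at `t = 0`.
  let γ (t : F) := m (B + t • 1) (C + t • 1)
  have hγ (t : F) : γ t = t ^ 2 • m 1 1 + t • (m B 1 + m 1 C) + m B C := by
    simp only [γ, m, TensorProduct.map_add_left, TensorProduct.map_add_right,
      TensorProduct.map_smul_left, TensorProduct.map_smul_right, LinearMap.add_apply,
      LinearMap.smul_apply]
    module
  have h0 : m B C = γ 0 := by rw [hγ]; simp
  change m B C ∈ _
  rw [h0]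
  refine mem_zariskiClosure_of_infinite γ (fun φ => ?_) ?_ 0
  · refine ⟨Polynomial.X ^ 2 * Polynomial.C (φ (m 1 1)) +
      Polynomial.X * Polynomial.C (φ (m B 1 + m 1 C)) + Polynomial.C (φ (m B C)), fun t => ?_⟩
    rw [hγ]
    simp only [Polynomial.eval_add, Polynomial.eval_mul, Polynomial.eval_pow, Polynomial.eval_X,
      Polynomial.eval_C, map_add, map_smul, smul_eq_mul]
  · refine ((Module.End.finite_spectrum (-B)).union
      (Module.End.finite_spectrum (-C))).infinite_compl.mono fun t ht => ?_
    rw [Set.compl_union] at ht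
    have hB : IsUnit (algebraMap F _ t - -B) := not_not.mp ht.1
    have hC : IsUnit (algebraMap F _ t - -C) := not_not.mp ht.2
    rw [sub_neg_eq_add, add_comm, Algebra.algebraMap_eq_smul_one, Module.End.isUnit_iff] at hB hC
    exact ⟨(g, LinearEquiv.ofBijective _ hB, LinearEquiv.ofBijective _ hC), rfl⟩

theorem padding_mem_zariskiClosure_orbit [Infinite F] [FiniteDimensional F L] {k n r : ℕ}
    (hk : 1 ≤ k) (bU : Module.Basis (Fin k) F U) (bL : Module.Basis (BlockIndex k n r) F L)
    {V' W' : Submodule F L} (hV' : Module.finrank F V' = n) {T : U ⊗[F] (V' ⊗[F] W')}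
    (hT : T ∈ minrankVariety F U V' W' r) :
    padding F U V' W' T ∈ zariskiClosure F (orbit F (blockTensor F bU bL)) := by
  obtain ⟨x, hx, hr⟩ := hT
  obtain ⟨u, rfl⟩ := exists_basis_coord_eq bU ⟨0, hk⟩ x hx
  have hrk (i : Fin k) : rk F (contract F (u.coord i) T) ≤
      Fintype.card (Fin (if (i : ℕ) = 0 then r else n)) := by
    rw [Fintype.card_fin]
    split_ifs with hi
    · rwa [show i = ⟨0, hk⟩ from Fin.ext hi]
    · exact hV' ▸ rk_le_finrank_left _
  choose v w hvw using fun i => exists_eq_sum_tmul_of_rk_le _ (hrk i)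
  -- `B` and `C` send the basis of `L` to the chosen simple factors and need not be invertible.
  let B : L →ₗ[F] L := bL.constr F fun ij => (v ij.1 ij.2 : L)
  let C : L →ₗ[F] L := bL.constr F fun ij => (w ij.1 ij.2 : L)
  let g : U ≃ₗ[F] U := bU.equiv u (Equiv.refl _)
  have heq : padding F U V' W' T = TensorProduct.map g.toLinearMap (TensorProduct.map B C)
      (blockTensor F bU bL) := by
    conv_lhs => rw [← sum_basis_tmul_contract u T]
    rw [blockTensor, map_sum, map_sum]
    refine Finset.sum_congr rfl fun i _ => ?_
    rw [hvw i]
    simp [padding, B, C, g]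
  rw [heq]
  exact map_mem_zariskiClosure_orbit _ _ _ _

/-- Inside `U ⊗ V' ⊗ W'`, the minrank variety is cut out by the orbit closure of the block
tensor. -/
theorem image_padding_minrankVariety [IsAlgClosed F] [FiniteDimensional F L] {k n r : ℕ}
    (hk : 1 ≤ k) (bU : Module.Basis (Fin k) F U) (bL : Module.Basis (BlockIndex k n r) F L)
    (V' W' : Submodule F L) (hV' : Module.finrank F V' = n) :
    padding F U V' W' '' minrankVariety F U V' W' r =
      zariskiClosure F (orbit F (blockTensor F bU bL)) ∩ Set.range (padding F U V' W') := by
  have : FiniteDimensional F U := bU.finiteDimensional_of_finite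
  apply Set.Subset.antisymm
  · rintro _ ⟨T, hT, rfl⟩
    exact ⟨padding_mem_zariskiClosure_orbit hk bU bL hV' hT, T, rfl⟩
  · rintro _ ⟨hT, T, rfl⟩
    exact ⟨T, mem_minrankVariety_of_padding_mem (zariskiClosure_subset
      (isZariskiClosed_minrankVariety r)
      (orbit_subset_minrankVariety (blockTensor_mem_minrankVariety hk bU bL)) hT), rfl⟩

end OrbitClosure

end Minrank

end

theorem mainTheorem6 {F U V W L : Type*} [Field F] [IsAlgClosed F]
    [AddCommGroup U] [Module F U] [FiniteDimensional F U]
    [AddCommGroup V] [Module F V] [FiniteDimensional F V]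
    [AddCommGroup W] [Module F W] [FiniteDimensional F W]
    [AddCommGroup L] [Module F L] [FiniteDimensional F L] (r : ℕ) :
    -- the tensors of minrank at most `r` form the minrank variety, which is Zariski closed
    ({T : TensorProduct F U (TensorProduct F V W) | Minrank.minrank F T ≤ (r : ℕ∞)} =
        Minrank.minrankVariety F U V W r ∧
      Minrank.IsZariskiClosed F (Minrank.minrankVariety F U V W r)) ∧
    -- it is the cone over the projection of the closed projective incidence variety
    (Minrank.IsBiprojClosed F (Minrank.projIncidence F U V W r) ∧
      Prod.fst '' Minrank.projIncidence F U V W r = Minrank.projMinrankVariety F U V W r ∧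
      Minrank.IsProjClosed F (Minrank.projMinrankVariety F U V W r) ∧
      (Nontrivial U →
        Minrank.minrankVariety F U V W r =
          Minrank.affineCone F (Minrank.projMinrankVariety F U V W r))) ∧
    -- the description as an orbit closure, for subspaces `V'`, `W'` of `L`
    (∀ (k n : ℕ), 1 ≤ k → Module.finrank F U = k → Module.finrank F L = (k - 1) * n + r →
      ∀ (bU : Module.Basis (Fin k) F U) (bL : Module.Basis (Minrank.BlockIndex k n r) F L)
        (V' W' : Submodule F L), Module.finrank F V' = n →
        Minrank.padding F U V' W' '' Minrank.minrankVariety F U V' W' r =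
          Minrank.zariskiClosure F (Minrank.orbit F (Minrank.blockTensor F bU bL)) ∩
            Set.range (Minrank.padding F U V' W')) := by
  refine ⟨⟨Minrank.setOf_minrank_le r, Minrank.isZariskiClosed_minrankVariety r⟩,
    ⟨Minrank.isBiprojClosed_projIncidence r, Minrank.image_fst_projIncidence r,
      (Minrank.isZariskiClosed_minrankVariety r).isProjClosed
        fun _ hT c => Minrank.smul_mem_minrankVariety hT c,
      fun _ => Minrank.minrankVariety_eq_affineCone r⟩, ?_⟩
  intro k n hk _ _ bU bL V' W' hV'
  exact Minrank.image_padding_minrankVariety hk bU bL V' W' hV'
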